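/- Let $\mathcal C$ be one of the following four categories: (a) $\mathbf{Set}$, sets and maps; (b) $\mathbf{CGWH}$, compactly generated weakly Hausdorff spaces and continuous maps; (c) $\mathbf{QuasiBorel}$, quasi-Borel spaces (sets $X$ with a set $M_X$ of maps $\mathbb R\to X$ that contains the constant maps and is closed under precomposition with measurable maps $\mathbb R\to\mathbb R$ and under gluing along countable Borel partitions of $\mathbb R$) and maps $f$ with $f\circ M_X\subseteq M_Y$; (d) $\mathbf{Diffeology}$, diffeological spaces and smooth maps. Then $\mathcal C$ has finite products and is Cartesian closed. Write $\otimes$ for the product, $1$ for the terminal object, $[X,Y]$ for the internal hom and $\mathrm{ev}_{X,Y}:X\otimes[X,Y]\to Y$ for the evaluation. Let $T$ be a monoid object of $\mathcal C$ (the time object), with multiplication $\mathrm{add}:T\otimes T\to T$ and unit $1\to T$, regarded as a one-object category enriched over $\mathcal C$. A dynamical system with time $T$ is an enriched functor $\Phi$ from this one-object category to $\mathcal C$, where $\mathcal C$ is enriched over itself by its internal homs; equivalently, it consists of an object $\Omega$ (its domain) and a morphism $\Phi^\sharp:T\to[\Omega,\Omega]$ that respects units and composition. Its flow form $\Phi:T\otimes\Omega\to\Omega$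 is the adjoint of $\Phi^\sharp$. With enriched natural transformations as morphisms (i.e. morphisms $h:\Omega\to\Omega'$ that satisfy the enriched naturality condition), these systems form a category $\mathbf{Dyn}_T(\mathcal C)$. For an instant $t:1\to T$ let $\Phi^t:\Omega\to\Omega$ be the corresponding time-$t$ map, and similarly for any morphism $T\otimes Y\to Y$. (i) For every object $X$ of $\mathcal C$ (in particular for $X=T$) and every dynamical system $\Phi$ with domain $\Omega$, let $\mathcal L_\Phi:T\otimes[X,\Omega]\to[X,\Omega]$ be the adjoint of the composite $$X\otimes T\otimes[X,\Omega]\xrightarrow{\mathrm{swap}\otimes\mathrm{id}}T\otimes X\otimes[X,\Omega]\xrightarrow{T\otimes\mathrm{ev}_{X,\Omega}}T\otimes\Omega\xrightarrow{\Phi}\Omega .$$ Then $\mathcal L_\Phi$ is the flow form of a dynamical system in $\mathcal C$ with domain $[X,\Omega]$, and $\Phi\mapsto\mathcal L_\Phi$ is the object part of a functor $\mathbf{Dyn}_T(\mathcal C)\to\mathbf{Dyn}_T(\mathcal C)$ which sends a morphism $h$ to $[X,h]$. It is the pointwise action on curves: for every $t:1\to T$ and every curve $c:X\to\Omega$, the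 map $\mathcal L_\Phi^t$ sends the point $1\to[X,\Omega]$ that names $c$ to the point that names $\Phi^t\circ c$. (ii) For every object $\Omega$ let $\sigma_\Omega:T\otimes[T,\Omega]\to[T,\Omega]$ be the adjoint of $$T\otimes T\otimes[T,\Omega]\xrightarrow{\mathrm{add}\otimes\mathrm{id}}T\otimes[T,\Omega]\xrightarrow{\mathrm{ev}_{T,\Omega}}\Omega .$$ Then $\sigma_\Omega$ is the flow form of a dynamical system in $\mathcal C$ whose domain is the path space $[T,\Omega]$, and $\Omega\mapsto\sigma_\Omega$ is the object part of a functor $\mathcal C\to\mathbf{Dyn}_T(\mathcal C)$ which sends a morphism $f$ to $[T,f]$; composed with the functor that sends a system to its domain, it yields a functor $\mathbf{Dyn}_T(\mathcal C)\to\mathbf{Dyn}_T(\mathcal C)$ that associates to $\Phi$ the shift flow on the path space of its domain. For every $t:1\to T$ and every path $c:T\to\Omega$, the map $\sigma_\Omega^t$ sends the point that names $c$ to the point that names $s\mapsto c(\mathrm{add}(s,t))$. -/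

import Mathlib

open CategoryTheory MonoidalCategory MonObj
open scoped CategoryTheory.MonoidalClosed

universe u v w

/-! ### Dynamics in a closed braided monoidal category -/

section Dynamics

variable {C : Type v} [Category.{w} C] [MonoidalCategory C]

/-- A monoid object `T` (the time object), regarded as a one-object category enriched over the
context category: the hom-object of the unique object is `T`. -/
def TimeCat (_T : C) : Type := PUnit

/-- The unique object of the one-object category of times. -/
def TimeCat.star (T : C) : TimeCat T := PUnit.unit

/-- Composition in an enriched category is written in diagrammatic order in Mathlib (first `a`,
then `b`), so that the composite of the times `a` and `b` is the product `b * a`. -/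
instance TimeCat.enriched [BraidedCategory C] (T : C) [MonObj T] :
    EnrichedCategory C (TimeCat T) where
  Hom _ _ := T
  id _ := η[T]
  comp _ _ _ := (β_ T T).hom ≫ μ[T]
  id_comp _ _ := by
    simp only [BraidedCategory.braiding_naturality_left_assoc, braiding_tensorUnit_left,
      Category.assoc, MonObj.mul_one, Iso.inv_hom_id_assoc, Iso.inv_hom_id]
  comp_id _ _ := by
    simp only [BraidedCategory.braiding_naturality_right_assoc, braiding_tensorUnit_right,
      Category.assoc, MonObj.one_mul, Iso.inv_hom_id_assoc, Iso.inv_hom_id]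
  assoc _ _ _ _ := by
    simp only [BraidedCategory.braiding_naturality_left_assoc, MonoidalCategory.whiskerLeft_comp,
      comp_whiskerRight, BraidedCategory.braiding_naturality_right_assoc, Category.assoc,
      BraidedCategory.braiding_tensor_left_hom, BraidedCategory.braiding_tensor_right_hom,
      Iso.inv_hom_id_assoc, MonObj.mul_assoc]
    rw [← BraidedCategory.yang_baxter_assoc]

variable [BraidedCategory C] [MonoidalClosed C]

/-- A dynamical system with time object `T` in the context category `C`: an enriched functor from
the one-object enriched category of times to `C`, where `C` is enriched over itself through its
internal homs. -/
structure Dynamics (T : C) [MonObj T] where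
  /-- the enriched functor -/
  functor : EnrichedFunctor C (TimeCat T) C

namespace Dynamics

variable {T : C} [MonObj T]

/-- The domain `Ω` of a dynamical system. -/
def dom (Φ : Dynamics T) : C := Φ.functor.obj (TimeCat.star T)

/-- The parametric form `T ⟶ [Ω, Ω]` of a dynamical system. -/
def param (Φ : Dynamics T) : T ⟶ (ihom Φ.dom).obj Φ.dom :=
  Φ.functor.map (TimeCat.star T) (TimeCat.star T)

/-- The flow form `T ⊗ Ω ⟶ Ω` of a dynamical system, the adjoint of its parametric form. -/
def flow (Φ : Dynamics T) : T ⊗ Φ.dom ⟶ Φ.dom :=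
  (β_ T Φ.dom).hom ≫ MonoidalClosed.uncurry Φ.param

/-- A morphism of dynamical systems is an enriched natural transformation, that is, a morphism
`h : Ω ⟶ Ω'` whose name `𝟙_ C ⟶ [Ω, Ω']` makes the enriched naturality diagram commute. -/
@[ext]
structure Hom (Φ Ψ : Dynamics T) where
  /-- the underlying morphism of domains -/
  hom : Φ.dom ⟶ Ψ.dom
  naturality :
    (λ_ T).inv ≫ (MonoidalClosed.curry' hom ⊗ₘ Ψ.param) ≫ eComp C Φ.dom Ψ.dom Ψ.dom =
      (ρ_ T).inv ≫ (Φ.param ⊗ₘ MonoidalClosed.curry' hom) ≫ eComp C Φ.dom Φ.dom Ψ.dom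

/-- Enriched naturality, rewritten through the functoriality of the internal hom. -/
lemma naturality_iff {Φ Ψ : Dynamics T} (h : Φ.dom ⟶ Ψ.dom) :
    ((λ_ T).inv ≫ (MonoidalClosed.curry' h ⊗ₘ Ψ.param) ≫ eComp C Φ.dom Ψ.dom Ψ.dom =
      (ρ_ T).inv ≫ (Φ.param ⊗ₘ MonoidalClosed.curry' h) ≫ eComp C Φ.dom Φ.dom Ψ.dom) ↔
    Ψ.param ≫ (MonoidalClosed.pre h).app Ψ.dom = Φ.param ≫ (ihom Φ.dom).map h := by
  have h₁ : (λ_ T).inv ≫ (MonoidalClosed.curry' h ⊗ₘ Ψ.param) ≫ eComp C Φ.dom Ψ.dom Ψ.dom =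
      Ψ.param ≫ (MonoidalClosed.pre h).app Ψ.dom := by
    rw [MonoidalClosed.enrichedCategorySelf_comp, MonoidalCategory.tensorHom_def',
      Category.assoc, ← leftUnitor_inv_naturality_assoc,
      MonoidalClosed.curry'_whiskerRight_comp, Iso.inv_hom_id_assoc]
  have h₂ : (ρ_ T).inv ≫ (Φ.param ⊗ₘ MonoidalClosed.curry' h) ≫ eComp C Φ.dom Φ.dom Ψ.dom =
      Φ.param ≫ (ihom Φ.dom).map h := by
    rw [MonoidalClosed.enrichedCategorySelf_comp, MonoidalCategory.tensorHom_def,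
      Category.assoc, ← rightUnitor_inv_naturality_assoc,
      MonoidalClosed.whiskerLeft_curry'_comp, Iso.inv_hom_id_assoc]
  rw [h₁, h₂]

/-- Dynamical systems with time object `T` and enriched natural transformations. -/
instance category : Category (Dynamics T) where
  Hom Φ Ψ := Hom Φ Ψ
  id Φ := ⟨𝟙 Φ.dom, (naturality_iff _).2 (by simp)⟩
  comp {Φ Ψ Θ} f g := ⟨f.hom ≫ g.hom, (naturality_iff _).2 (by
    have hf := (naturality_iff f.hom).1 f.naturality
    have hg := (naturality_iff g.hom).1 g.naturality
    rw [MonoidalClosed.pre_map, NatTrans.comp_app, reassoc_of% hg,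
      ← MonoidalClosed.pre_comm_ihom_map, reassoc_of% hf, Functor.map_comp])⟩
  id_comp _ := Hom.ext (Category.id_comp _)
  comp_id _ := Hom.ext (Category.comp_id _)
  assoc _ _ _ := Hom.ext (Category.assoc _ _ _)

variable (T) in
/-- The functor that sends a dynamical system to its domain. -/
def domain : Dynamics T ⥤ C where
  obj Φ := Φ.dom
  map f := f.hom

/-- `Φ` is a dynamical system with domain `Ω` and flow form `φ`. -/
def HasFlow (Φ : Dynamics T) (Ω : C) (φ : T ⊗ Ω ⟶ Ω) : Prop :=
  ∃ h : Φ.dom = Ω, Φ.flow ≫ eqToHom h = T ◁ eqToHom h ≫ φ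

end Dynamics

/-- The transfer operator on the `X`-shaped curves in `Ω` of a pre-flow `φ` on `Ω`: the adjoint of
`X ⊗ T ⊗ [X, Ω] ⟶ T ⊗ X ⊗ [X, Ω] ⟶ T ⊗ Ω ⟶ Ω`, `(x, t, c) ↦ φ (t, c x)`. -/
def transferOp {T Ω : C} (X : C) (φ : T ⊗ Ω ⟶ Ω) : T ⊗ (ihom X).obj Ω ⟶ (ihom X).obj Ω :=
  MonoidalClosed.curry ((α_ X T ((ihom X).obj Ω)).inv ≫ (β_ X T).hom ▷ (ihom X).obj Ω ≫
    (α_ T X ((ihom X).obj Ω)).hom ≫ T ◁ (ihom.ev X).app Ω ≫ φ)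

/-- The path space `[T, Ω]` of an object `Ω`. -/
abbrev pathSpace (T Ω : C) : C := (ihom T).obj Ω

/-- The shift on the path space of `Ω`: the adjoint of
`T ⊗ T ⊗ [T, Ω] ⟶ T ⊗ [T, Ω] ⟶ Ω`, `(s, t, c) ↦ c (s * t)`. -/
def pathShift (T : C) [MonObj T] (Ω : C) : T ⊗ pathSpace T Ω ⟶ pathSpace T Ω :=
  MonoidalClosed.curry ((α_ T T (pathSpace T Ω)).inv ≫ μ[T] ▷ pathSpace T Ω ≫
    (ihom.ev T).app Ω)

/-- The time-`t` map of a pre-flow, for an instant `t`, i.e. a point of the time object. -/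
def timeMap {T Ω : C} (φ : T ⊗ Ω ⟶ Ω) (t : 𝟙_ C ⟶ T) : Ω ⟶ Ω :=
  (λ_ Ω).inv ≫ t ▷ Ω ≫ φ

/-- The translation `s ↦ s * t` of the time object. -/
def timeTranslation {T : C} [MonObj T] (t : 𝟙_ C ⟶ T) : T ⟶ T :=
  (ρ_ T).inv ≫ T ◁ t ≫ μ[T]

end Dynamics

/-! ### The two induced dynamics -/

/-- The category `C` has finite products and is Cartesian closed. -/
def IsCartesianClosed (C : Type v) [Category.{w} C] : Prop :=
  ∃ _ : CartesianMonoidalCategory C, Nonempty (MonoidalClosed C)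

/-- In the context `C`, with whatever choice of products and exponentials, and for every
time object, the transfer operators on `X`-shaped curves and the shifts on path spaces are the flow
forms of dynamical systems in `C`, functorially in the given system, and at every instant they act
on curves by the usual pointwise formulas. -/
def InducesDynamics (C : Type v) [Category.{w} C] : Prop :=
  ∀ [CartesianMonoidalCategory C] [BraidedCategory C] [MonoidalClosed C] (T : C) [MonObj T],
    (∀ X : C,
      (∃ 𝒯 : Dynamics T ⥤ Dynamics T,
        (∀ Φ : Dynamics T, (𝒯.obj Φ).HasFlow ((ihom X).obj Φ.dom) (transferOp X Φ.flow)) ∧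
        𝒯 ⋙ Dynamics.domain T = Dynamics.domain T ⋙ ihom X) ∧
      (∀ (Φ : Dynamics T) (t : 𝟙_ C ⟶ T) (c : X ⟶ Φ.dom),
        MonoidalClosed.curry' c ≫ timeMap (transferOp X Φ.flow) t =
          MonoidalClosed.curry' (c ≫ timeMap Φ.flow t))) ∧
    ((∃ (𝒮 : Dynamics T ⥤ Dynamics T) (𝒮₀ : C ⥤ Dynamics T),
        𝒮 = Dynamics.domain T ⋙ 𝒮₀ ∧
        (∀ Ω : C, (𝒮₀.obj Ω).HasFlow (pathSpace T Ω) (pathShift T Ω)) ∧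
        𝒮₀ ⋙ Dynamics.domain T = ihom T) ∧
      (∀ (Ω : C) (t : 𝟙_ C ⟶ T) (c : T ⟶ Ω),
        MonoidalClosed.curry' c ≫ timeMap (pathShift T Ω) t =
          MonoidalClosed.curry' (timeTranslation t ≫ c)))

/-! ### Compactly generated weakly Hausdorff spaces -/

/-- A space is weakly Hausdorff if the image of every continuous map from a compact Hausdorff space
is closed. -/
class WeaklyHausdorffSpace (X : Type u) [TopologicalSpace X] : Prop where
  isClosed_range : ∀ (K : CompHaus.{u}) (f : C(K, X)), IsClosed (Set.range f)

/-- Compactly generated weakly Hausdorff spaces. -/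
structure CGWH : Type (u + 1) where
  /-- the underlying set -/
  carrier : Type u
  [top : TopologicalSpace carrier]
  [compactlyGenerated : CompactlyGeneratedSpace carrier]
  [weaklyHausdorff : WeaklyHausdorffSpace carrier]

attribute [instance] CGWH.top CGWH.compactlyGenerated CGWH.weaklyHausdorff

/-- The category of compactly generated weakly Hausdorff spaces and continuous maps. -/
instance CGWH.category : Category.{u} CGWH.{u} where
  Hom X Y := C(X.carrier, Y.carrier)
  id X := ContinuousMap.id X.carrier
  comp f g := g.comp f

/-! ### Quasi-Borel spaces -/

/-- A quasi-Borel structure: a set of random elements `ℝ → X` that contains the constants and is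
closed under measurable reparametrization and under gluing along countable Borel partitions. -/
class QuasiBorelSpace (X : Type u) where
  /-- the random elements -/
  rand : Set (ℝ → X)
  const_mem : ∀ x : X, (fun _ => x) ∈ rand
  comp_mem : ∀ α ∈ rand, ∀ f : ℝ → ℝ, Measurable f → α ∘ f ∈ rand
  glue_mem : ∀ s : ℕ → Set ℝ, (∀ i, MeasurableSet (s i)) → Pairwise (Function.onFun Disjoint s) →
    ⋃ i, s i = Set.univ → ∀ α : ℕ → ℝ → X, (∀ i, α i ∈ rand) →
      ∀ β : ℝ → X, (∀ i, ∀ r ∈ s i, β r = α i r) → β ∈ rand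

/-- Quasi-Borel spaces. -/
structure QuasiBorel : Type (u + 1) where
  /-- the underlying set -/
  carrier : Type u
  [str : QuasiBorelSpace carrier]

attribute [instance] QuasiBorel.str

/-- A morphism of quasi-Borel spaces is a map that sends random elements to random elements. -/
@[ext]
structure QuasiBorel.Hom (X Y : QuasiBorel.{u}) where
  /-- the underlying map -/
  toFun : X.carrier → Y.carrier
  map_rand : ∀ α ∈ QuasiBorelSpace.rand (X := X.carrier),
    toFun ∘ α ∈ QuasiBorelSpace.rand (X := Y.carrier)

/-- The category of quasi-Borel spaces. -/
instance QuasiBorel.category : Category.{u} QuasiBorel.{u} where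
  Hom X Y := QuasiBorel.Hom X Y
  id X := ⟨id, fun _ h => h⟩
  comp f g := ⟨g.toFun ∘ f.toFun, fun α h => g.map_rand _ (f.map_rand α h)⟩

/-! ### Diffeological spaces -/

/-- Diffeological spaces. -/
structure Diffeo : Type (u + 1) where
  /-- the underlying set -/
  carrier : Type u
  [str : DiffeologicalSpace carrier]

attribute [instance] Diffeo.str

/-- A morphism of diffeological spaces is a smooth map, i.e. one that sends plots to plots. -/
@[ext]
structure Diffeo.Hom (X Y : Diffeo.{u}) where
  /-- the underlying map -/
  toFun : X.carrier → Y.carrier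
  smooth : Diffeology.DSmooth toFun

/-- The category of diffeological spaces. -/
instance Diffeo.category : Category.{u} Diffeo.{u} where
  Hom X Y := Diffeo.Hom X Y
  id X := ⟨id, Diffeology.dSmooth_id⟩
  comp f g := ⟨g.toFun ∘ f.toFun, g.smooth.comp f.smooth⟩

/-! The statement splits into a formal part, valid in every Cartesian closed category, and the
Cartesian closedness of the four contexts. Formal part: by Yoneda, equations of morphisms may be
tested on generalized elements, where evaluation turns `[X, Y]` into functions (`hom_ext_of_eval`,
`eval_curry`). An enriched functor from `T` is then the same as an action of `T`, and enriched
naturality is equivariance (`ofFlow`, `homOfFlow`). Both laws for the transfer operator are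
inherited pointwise from `Φ`; those for the shift are the unit and associativity laws of `T`. Since
times translate paths on the right, the shift is a left action even if `T` is not commutative.
Closedness: for quasi-Borel and diffeological spaces, the function space carries the structure that
makes evaluation along a reparametrization and a random or smooth argument admissible. For `CGWH`,
products and mapping spaces are retopologized by compact Hausdorff test spaces. Weak Hausdorffness
survives because maps to weakly Hausdorff spaces separate their points
(`WeaklyHausdorffSpace.of_separating`). -/

/-! ### Calculus of generalized elements in a Cartesian closed category -/

section GeneralizedElements

open CartesianMonoidalCategory

variable {C : Type v} [Category.{w} C] [CartesianMonoidalCategory C]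

/-- Morphisms out of a product are determined by their values on pairs of generalized elements. -/
lemma hom_ext_of_lift {X Y Z : C} {f g : X ⊗ Y ⟶ Z}
    (h : ∀ (W : C) (x : W ⟶ X) (y : W ⟶ Y), lift x y ≫ f = lift x y ≫ g) : f = g := by
  simpa using h _ (fst X Y) (snd X Y)

/-- Morphisms into an internal hom are determined by the values of the resulting functions on
generalized elements. -/
lemma hom_ext_of_eval [MonoidalClosed C] {X Y Z : C} {f g : Z ⟶ (ihom X).obj Y}
    (h : ∀ (W : C) (x : W ⟶ X) (z : W ⟶ Z),
      lift x (z ≫ f) ≫ (ihom.ev X).app Y = lift x (z ≫ g) ≫ (ihom.ev X).app Y) : f = g := by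
  apply MonoidalClosed.uncurry_injective
  refine hom_ext_of_lift fun W x z => ?_
  simpa [MonoidalClosed.uncurry_eq] using h W x z

lemma lift_comp_uncurry [MonoidalClosed C] {X Y Z W : C} (f : Z ⟶ (ihom X).obj Y)
    (x : W ⟶ X) (z : W ⟶ Z) :
    lift x z ≫ MonoidalClosed.uncurry f = lift x (z ≫ f) ≫ (ihom.ev X).app Y := by
  simp [MonoidalClosed.uncurry_eq]

/-- Evaluation of a curried morphism on generalized elements. -/
lemma eval_curry [MonoidalClosed C] {X Y Z W : C} (f : X ⊗ Z ⟶ Y) (x : W ⟶ X) (z : W ⟶ Z) :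
    lift x (z ≫ MonoidalClosed.curry f) ≫ (ihom.ev X).app Y = lift x z ≫ f := by
  rw [← lift_comp_uncurry, MonoidalClosed.uncurry_curry]

lemma eval_ihom_map [MonoidalClosed C] {X Y Y' W : C} (f : Y ⟶ Y') (x : W ⟶ X)
    (c : W ⟶ (ihom X).obj Y) :
    lift x (c ≫ (ihom X).map f) ≫ (ihom.ev X).app Y' = (lift x c ≫ (ihom.ev X).app Y) ≫ f := by
  rw [← lift_comp_uncurry, MonoidalClosed.uncurry_ihom_map, Category.assoc]

lemma eval_pre [MonoidalClosed C] {X X' Y W : C} (f : X ⟶ X') (x : W ⟶ X)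
    (c : W ⟶ (ihom X').obj Y) :
    lift x (c ≫ (MonoidalClosed.pre f).app Y) ≫ (ihom.ev X).app Y =
      lift (x ≫ f) c ≫ (ihom.ev X').app Y := by
  rw [← lift_comp_uncurry, MonoidalClosed.uncurry_pre, lift_whiskerRight_assoc]

lemma eval_curry' [MonoidalClosed C] {X Y W : C} (f : X ⟶ Y) (x : W ⟶ X) (p : W ⟶ 𝟙_ C) :
    lift x (p ≫ MonoidalClosed.curry' f) ≫ (ihom.ev X).app Y = x ≫ f := by
  rw [MonoidalClosed.curry', eval_curry, lift_rightUnitor_hom_assoc]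

lemma eval_eId [MonoidalClosed C] {X W : C} (x : W ⟶ X) (p : W ⟶ 𝟙_ C) :
    lift x (p ≫ eId C X) ≫ (ihom.ev X).app X = x := by
  rw [MonoidalClosed.enrichedCategorySelf_id, MonoidalClosed.id_eq, eval_curry,
    lift_rightUnitor_hom]

lemma eval_eComp [MonoidalClosed C] {X Y Z W : C} (x : W ⟶ X) (f : W ⟶ (ihom X).obj Y)
    (g : W ⟶ (ihom Y).obj Z) :
    lift x (lift f g ≫ eComp C X Y Z) ≫ (ihom.ev X).app Z =
      lift (X := Y) (lift x f ≫ (ihom.ev X).app Y) g ≫ (ihom.ev Y).app Z := by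
  rw [MonoidalClosed.enrichedCategorySelf_comp, MonoidalClosed.comp_eq, eval_curry,
    MonoidalClosed.compTranspose_eq, lift_lift_associator_inv_assoc, lift_whiskerRight_assoc]

end GeneralizedElements

/-! ### Dynamical systems as actions of the time object -/

section ActionForm

open CartesianMonoidalCategory

variable {C : Type v} [Category.{w} C] [CartesianMonoidalCategory C]

/-- The unit law of an action of a monoid object, on generalized elements. -/
def IsUnitalFlow {T : C} [MonObj T] {Ω : C} (φ : T ⊗ Ω ⟶ Ω) : Prop :=
  ∀ (W : C) (p : W ⟶ 𝟙_ C) (x : W ⟶ Ω), lift (p ≫ η[T]) x ≫ φ = x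

/-- The composition law of an action of a monoid object, on generalized elements. -/
def IsAssocFlow {T : C} [MonObj T] {Ω : C} (φ : T ⊗ Ω ⟶ Ω) : Prop :=
  ∀ (W : C) (s t : W ⟶ T) (x : W ⟶ Ω),
    lift (lift s t ≫ μ[T]) x ≫ φ = lift s (lift t x ≫ φ) ≫ φ

lemma lift_mul_unit {T W : C} [MonObj T] (p : W ⟶ 𝟙_ C) (t : W ⟶ T) :
    lift t (p ≫ η[T]) ≫ μ[T] = t := by
  rw [← lift_whiskerLeft_assoc, MonObj.mul_one, lift_rightUnitor_hom]

lemma lift_mul_mul {T W : C} [MonObj T] (r s t : W ⟶ T) :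
    lift (lift r s ≫ μ[T]) t ≫ μ[T] = lift r (lift s t ≫ μ[T]) ≫ μ[T] := by
  rw [← lift_whiskerRight_assoc, MonObj.mul_assoc, lift_lift_associator_hom_assoc,
    lift_whiskerLeft_assoc]

lemma comp_timeMap {T Ω W : C} (φ : T ⊗ Ω ⟶ Ω) (t : 𝟙_ C ⟶ T) (x : W ⟶ Ω) :
    x ≫ timeMap φ t = lift (toUnit W ≫ t) x ≫ φ := by
  have e : x ≫ (λ_ Ω).inv = lift (toUnit W) x := by ext; simp
  rw [timeMap, reassoc_of% e, lift_whiskerRight_assoc]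

lemma comp_timeTranslation {T W : C} [MonObj T] (t : 𝟙_ C ⟶ T) (s : W ⟶ T) :
    s ≫ timeTranslation t = lift s (toUnit W ≫ t) ≫ μ[T] := by
  have e : s ≫ (ρ_ T).inv = lift s (toUnit W) := by ext; simp
  rw [timeTranslation, reassoc_of% e, lift_whiskerLeft_assoc]

lemma eval_pathShift [MonoidalClosed C] {T Ω W : C} [MonObj T] (s t : W ⟶ T)
    (c : W ⟶ pathSpace T Ω) :
    lift s (lift t c ≫ pathShift T Ω) ≫ (ihom.ev T).app Ω =
      lift (lift s t ≫ μ[T]) c ≫ (ihom.ev T).app Ω := by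
  rw [pathShift, eval_curry, lift_lift_associator_inv_assoc, lift_whiskerRight_assoc]

lemma isUnitalFlow_pathShift [MonoidalClosed C] {T : C} [MonObj T] (Ω : C) :
    IsUnitalFlow (pathShift T Ω) := by
  intro W p c
  refine hom_ext_of_eval fun V x z => ?_
  rw [comp_lift_assoc, eval_pathShift, ← Category.assoc z, lift_mul_unit]

/-- Evaluated at `x`, the two sides are `c (x * (s * t))` and `c ((x * s) * t)`. -/
lemma isAssocFlow_pathShift [MonoidalClosed C] {T : C} [MonObj T] (Ω : C) :
    IsAssocFlow (pathShift T Ω) := by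
  intro W s t c
  refine hom_ext_of_eval fun V x z => ?_
  rw [comp_lift_assoc, comp_lift_assoc, comp_lift_assoc, comp_lift_assoc, eval_pathShift,
    eval_pathShift, eval_pathShift, lift_mul_mul]

variable [BraidedCategory C] [MonoidalClosed C]

namespace Dynamics

variable {T : C} [MonObj T]

lemma eval_param (Φ : Dynamics T) {W : C} (x : W ⟶ Φ.dom) (t : W ⟶ T) :
    lift x (t ≫ Φ.param) ≫ (ihom.ev Φ.dom).app Φ.dom = lift t x ≫ Φ.flow := by
  rw [flow, lift_braiding_hom_assoc, lift_comp_uncurry]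

lemma isUnitalFlow_flow (Φ : Dynamics T) : IsUnitalFlow Φ.flow := by
  intro W p x
  rw [← eval_param, Category.assoc]
  have h : η[T] ≫ Φ.param = eId C Φ.dom := Φ.functor.map_id (TimeCat.star T)
  rw [h, eval_eId]

lemma isAssocFlow_flow (Φ : Dynamics T) : IsAssocFlow Φ.flow := by
  intro W s t x
  have h : ((β_ T T).hom ≫ μ[T]) ≫ Φ.param =
      (Φ.param ⊗ₘ Φ.param) ≫ eComp C Φ.dom Φ.dom Φ.dom :=
    Φ.functor.map_comp (TimeCat.star T) (TimeCat.star T) (TimeCat.star T)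
  -- The order is reversed because enriched composition is diagrammatic: `t` acts first. The
  -- braiding in the composition of `TimeCat` restores the product `s * t`.
  have h' : (lift s t ≫ μ[T]) ≫ Φ.param =
      lift (t ≫ Φ.param) (s ≫ Φ.param) ≫ eComp C Φ.dom Φ.dom Φ.dom := by
    have := lift t s ≫= h
    simpa only [lift_map_assoc, Category.assoc, lift_braiding_hom_assoc] using this
  rw [← eval_param, h', eval_eComp, eval_param, eval_param]

/-- The dynamical system whose flow form is a given action of the time object. -/
def ofFlow (Ω : C) (φ : T ⊗ Ω ⟶ Ω) (h₁ : IsUnitalFlow φ) (h₂ : IsAssocFlow φ) :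
    Dynamics T where
  functor :=
    { obj _ := Ω
      map _ _ := MonoidalClosed.curry ((β_ Ω T).hom ≫ φ)
      map_id _ := by
        change η[T] ≫ MonoidalClosed.curry ((β_ Ω T).hom ≫ φ) = eId C Ω
        refine hom_ext_of_eval fun W x p => ?_
        rw [← Category.assoc, eval_curry, lift_braiding_hom_assoc, eval_eId, h₁]
      map_comp _ _ _ := by
        change ((β_ T T).hom ≫ μ[T]) ≫ MonoidalClosed.curry ((β_ Ω T).hom ≫ φ) =
          (MonoidalClosed.curry ((β_ Ω T).hom ≫ φ) ⊗ₘ MonoidalClosed.curry ((β_ Ω T).hom ≫ φ)) ≫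
            eComp C Ω Ω Ω
        refine hom_ext_of_eval fun W x z => ?_
        obtain ⟨t, s, rfl⟩ : ∃ t s, z = lift t s := ⟨z ≫ fst _ _, z ≫ snd _ _, by simp⟩
        rw [← Category.assoc, eval_curry, lift_map_assoc, eval_eComp, eval_curry, eval_curry,
          lift_braiding_hom_assoc, lift_braiding_hom_assoc, lift_braiding_hom_assoc,
          lift_braiding_hom_assoc, h₂] }

@[simp]
lemma dom_ofFlow (Ω : C) (φ : T ⊗ Ω ⟶ Ω) (h₁ : IsUnitalFlow φ) (h₂ : IsAssocFlow φ) :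
    (ofFlow Ω φ h₁ h₂).dom = Ω := rfl

lemma flow_ofFlow (Ω : C) (φ : T ⊗ Ω ⟶ Ω) (h₁ : IsUnitalFlow φ) (h₂ : IsAssocFlow φ) :
    (ofFlow Ω φ h₁ h₂).flow = φ := by
  change (β_ T Ω).hom ≫ MonoidalClosed.uncurry (MonoidalClosed.curry ((β_ Ω T).hom ≫ φ)) = φ
  -- Any braiding on a Cartesian monoidal category is symmetric, so the two swaps cancel.
  rw [MonoidalClosed.uncurry_curry, SymmetricCategory.symmetry_assoc]

lemma hasFlow_ofFlow (Ω : C) (φ : T ⊗ Ω ⟶ Ω) (h₁ : IsUnitalFlow φ) (h₂ : IsAssocFlow φ) :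
    (ofFlow Ω φ h₁ h₂).HasFlow Ω φ := by
  refine ⟨rfl, ?_⟩
  rw [flow_ofFlow]
  change φ ≫ 𝟙 Ω = T ◁ 𝟙 Ω ≫ φ
  simp

/-- A morphism of domains that is equivariant for the flow forms is a morphism of dynamical
systems. -/
def homOfFlow {Φ Ψ : Dynamics T} (h : Φ.dom ⟶ Ψ.dom)
    (hh : ∀ (W : C) (t : W ⟶ T) (x : W ⟶ Φ.dom),
      lift t (x ≫ h) ≫ Ψ.flow = (lift t x ≫ Φ.flow) ≫ h) : Φ ⟶ Ψ :=
  Dynamics.Hom.mk h <| (naturality_iff h).2 <| hom_ext_of_eval fun W x t => by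
    rw [← Category.assoc t, ← Category.assoc t, eval_pre, eval_ihom_map, eval_param, eval_param, hh]

/-- Converse of `homOfFlow`: enriched naturality evaluated at `x` and `t`. -/
lemma Hom.equivariant {Φ Ψ : Dynamics T} (h : Φ ⟶ Ψ) {W : C} (t : W ⟶ T) (x : W ⟶ Φ.dom) :
    lift t (x ≫ h.hom) ≫ Ψ.flow = (lift t x ≫ Φ.flow) ≫ h.hom := by
  have e := (naturality_iff h.hom).1 h.naturality
  rw [← eval_param, ← eval_param, ← eval_pre, ← eval_ihom_map, Category.assoc, Category.assoc, e]

end Dynamics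

variable {T : C}

lemma eval_transferOp {Ω W : C} (X : C) (φ : T ⊗ Ω ⟶ Ω) (x : W ⟶ X) (t : W ⟶ T)
    (c : W ⟶ (ihom X).obj Ω) :
    lift x (lift t c ≫ transferOp X φ) ≫ (ihom.ev X).app Ω =
      lift (Y := Ω) t (lift x c ≫ (ihom.ev X).app Ω) ≫ φ := by
  rw [transferOp, eval_curry, lift_lift_associator_inv_assoc, lift_whiskerRight_assoc,
    lift_braiding_hom, lift_lift_associator_hom_assoc, lift_whiskerLeft_assoc]

variable [MonObj T]

lemma IsUnitalFlow.transferOp {Ω : C} {φ : T ⊗ Ω ⟶ Ω} (h : IsUnitalFlow φ) (X : C) :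
    IsUnitalFlow (transferOp X φ) := by
  intro W p c
  refine hom_ext_of_eval fun V x z => ?_
  rw [comp_lift_assoc, eval_transferOp, ← Category.assoc z, h]

/-- After evaluation at `x`, this is the composition law of `φ` at the element `c x`. -/
lemma IsAssocFlow.transferOp {Ω : C} {φ : T ⊗ Ω ⟶ Ω} (h : IsAssocFlow φ) (X : C) :
    IsAssocFlow (transferOp X φ) := by
  intro W s t c
  refine hom_ext_of_eval fun V x z => ?_
  rw [comp_lift_assoc, comp_lift_assoc, comp_lift_assoc, comp_lift_assoc, eval_transferOp,
    eval_transferOp, eval_transferOp, h]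

variable (T) in
/-- The transfer operators on `X`-shaped curves, as an endofunctor of dynamical systems. -/
def transferFunctor (X : C) : Dynamics T ⥤ Dynamics T where
  obj Φ := .ofFlow ((ihom X).obj Φ.dom) (transferOp X Φ.flow)
    (Φ.isUnitalFlow_flow.transferOp X) (Φ.isAssocFlow_flow.transferOp X)
  map {Φ Ψ} h := Dynamics.homOfFlow ((ihom X).map h.hom) fun W t c => by
    rw [Dynamics.flow_ofFlow, Dynamics.flow_ofFlow]
    refine hom_ext_of_eval fun V x z => ?_
    dsimp only [Dynamics.dom_ofFlow] at c ⊢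
    rw [comp_lift_assoc, eval_transferOp, ← Category.assoc z, eval_ihom_map,
      Dynamics.Hom.equivariant, ← Category.assoc z, eval_ihom_map, comp_lift_assoc,
      eval_transferOp]
  map_id Φ := Dynamics.Hom.ext ((ihom X).map_id Φ.dom)
  map_comp f g := Dynamics.Hom.ext ((ihom X).map_comp f.hom g.hom)

variable (T) in
/-- The shifts on path spaces, as a functor to dynamical systems. -/
def pathShiftFunctor : C ⥤ Dynamics T where
  obj Ω := .ofFlow (pathSpace T Ω) (pathShift T Ω)
    (isUnitalFlow_pathShift Ω) (isAssocFlow_pathShift Ω)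
  map {Ω Ω'} f := Dynamics.homOfFlow ((ihom T).map f) fun W t c => by
    rw [Dynamics.flow_ofFlow, Dynamics.flow_ofFlow]
    refine hom_ext_of_eval fun V s z => ?_
    dsimp only [Dynamics.dom_ofFlow] at c ⊢
    rw [comp_lift_assoc, eval_pathShift, ← Category.assoc z, eval_ihom_map, ← Category.assoc z,
      eval_ihom_map, comp_lift_assoc, eval_pathShift]
  map_id Ω := Dynamics.Hom.ext ((ihom T).map_id Ω)
  map_comp f g := Dynamics.Hom.ext ((ihom T).map_comp f g)

end ActionForm

open CartesianMonoidalCategory in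
/-- Transfer operators and path shifts are dynamical systems in every Cartesian closed category. -/
theorem inducesDynamics (C : Type v) [Category.{w} C] : InducesDynamics C := by
  intro _ _ _ T _
  -- The equations of functors hold by `rfl`, since `ofFlow` has the prescribed domain
  -- definitionally and morphisms are sent to their images under the internal hom.
  refine ⟨fun X => ⟨⟨transferFunctor T X, fun Φ => Dynamics.hasFlow_ofFlow _ _
      (Φ.isUnitalFlow_flow.transferOp X) (Φ.isAssocFlow_flow.transferOp X), rfl⟩,
    fun Φ t c => ?_⟩, ⟨⟨Dynamics.domain T ⋙ pathShiftFunctor T, pathShiftFunctor T, rfl,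
      fun Ω => Dynamics.hasFlow_ofFlow _ _
        (isUnitalFlow_pathShift Ω) (isAssocFlow_pathShift Ω), rfl⟩, fun Ω t c => ?_⟩⟩
  · refine hom_ext_of_eval fun W x p => ?_
    rw [comp_timeMap, comp_lift_assoc, eval_transferOp, eval_curry', eval_curry',
      ← Category.assoc x, comp_timeMap, ← Category.assoc p, comp_toUnit]
  · refine hom_ext_of_eval fun W s p => ?_
    rw [comp_timeMap, comp_lift_assoc, eval_pathShift, eval_curry', eval_curry',
      ← Category.assoc s, comp_timeTranslation, ← Category.assoc p, comp_toUnit]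

/-! ### A criterion for Cartesian closedness -/

section Criterion

open Limits

/-- A category with a terminal object, binary products and exponentials, each given by
its universal property, is Cartesian closed. -/
theorem IsCartesianClosed.of_universal {C : Type v} [Category.{w} C] (one : C)
    (toOne : ∀ X : C, X ⟶ one) (toOne_unique : ∀ {X : C} (f : X ⟶ one), f = toOne X)
    (prod : C → C → C) (fst : ∀ X Y, prod X Y ⟶ X) (snd : ∀ X Y, prod X Y ⟶ Y)
    (pair : ∀ {W X Y : C} (_ : W ⟶ X) (_ : W ⟶ Y), W ⟶ prod X Y)
    (pair_fst : ∀ {W X Y : C} (f : W ⟶ X) (g : W ⟶ Y), pair f g ≫ fst X Y = f)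
    (pair_snd : ∀ {W X Y : C} (f : W ⟶ X) (g : W ⟶ Y), pair f g ≫ snd X Y = g)
    (prod_ext : ∀ {W X Y : C} {f g : W ⟶ prod X Y}, f ≫ fst X Y = g ≫ fst X Y →
      f ≫ snd X Y = g ≫ snd X Y → f = g)
    (exp : C → C → C) (ev : ∀ X Y, prod X (exp X Y) ⟶ Y)
    (curry : ∀ {X Y Z : C} (_ : prod X Z ⟶ Y), Z ⟶ exp X Y)
    (pair_curry_ev : ∀ {X Y Z : C} (f : prod X Z ⟶ Y),
      pair (fst X Z) (snd X Z ≫ curry f) ≫ ev X Y = f)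
    (exp_ext : ∀ {X Y Z : C} {f g : Z ⟶ exp X Y},
      pair (fst X Z) (snd X Z ≫ f) ≫ ev X Y = pair (fst X Z) (snd X Z ≫ g) ≫ ev X Y → f = g) :
    IsCartesianClosed C := by
  let 𝒯 : LimitCone (Functor.empty.{0} C) :=
    ⟨asEmptyCone one, IsTerminal.ofUniqueHom toOne fun _ f => toOne_unique f⟩
  let ℬ : ∀ X Y : C, LimitCone (Limits.pair X Y) := fun X Y =>
    ⟨BinaryFan.mk (fst X Y) (snd X Y), BinaryFan.IsLimit.mk _ (fun f g => pair f g)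
      (fun f g => pair_fst f g) (fun f g => pair_snd f g)
      (fun f g m h₁ h₂ => prod_ext (h₁.trans (pair_fst f g).symm) (h₂.trans (pair_snd f g).symm))⟩
  let _ : CartesianMonoidalCategory C := .ofChosenFiniteProducts 𝒯 ℬ
  have whiskerLeft_eq : ∀ (X : C) {Z Z' : C} (f : Z ⟶ Z'),
      (X ◁ f : X ⊗ Z ⟶ X ⊗ Z') = pair (fst X Z) (snd X Z ≫ f) := fun X Z Z' f =>
    prod_ext ((CartesianMonoidalCategory.whiskerLeft_fst X f).trans (pair_fst _ _).symm)
      ((CartesianMonoidalCategory.whiskerLeft_snd X f).trans (pair_snd _ _).symm)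
  let e : ∀ X Z Y : C, ((tensorLeft X).obj Z ⟶ Y) ≃ (Z ⟶ exp X Y) := fun X Z Y =>
    { toFun f := curry f
      invFun g := X ◁ g ≫ ev X Y
      left_inv f := (congrArg (· ≫ ev X Y) (whiskerLeft_eq X (curry f))).trans (pair_curry_ev f)
      right_inv g := exp_ext <| (pair_curry_ev _).trans
        (congrArg (· ≫ ev X Y) (whiskerLeft_eq X g)) }
  refine ⟨inferInstance, ⟨⟨fun X => ⟨_, Adjunction.adjunctionOfEquivRight (e X) ?_⟩⟩⟩⟩
  intro Z' Z Y f g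
  -- Moved to the uncurried side, naturality is only functoriality of `X ◁ -`.
  rw [← Equiv.eq_symm_apply]
  change X ◁ f ≫ g = X ◁ (f ≫ e X Z Y g) ≫ ev X Y
  rw [MonoidalCategory.whiskerLeft_comp, Category.assoc]
  exact congrArg (X ◁ f ≫ ·) ((e X Z Y).symm_apply_apply g).symm

end Criterion

theorem isCartesianClosed_type : IsCartesianClosed (Type u) := ⟨inferInstance, ⟨inferInstance⟩⟩

/-! ### Quasi-Borel spaces -/

namespace QuasiBorel

instance (X Y : Type u) [QuasiBorelSpace X] [QuasiBorelSpace Y] : QuasiBorelSpace (X × Y) where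
  rand := {α | Prod.fst ∘ α ∈ QuasiBorelSpace.rand ∧ Prod.snd ∘ α ∈ QuasiBorelSpace.rand}
  const_mem x := ⟨QuasiBorelSpace.const_mem x.1, QuasiBorelSpace.const_mem x.2⟩
  comp_mem _ hα f hf :=
    ⟨QuasiBorelSpace.comp_mem _ hα.1 f hf, QuasiBorelSpace.comp_mem _ hα.2 f hf⟩
  glue_mem s hs hd hu α hα _ hβ :=
    ⟨QuasiBorelSpace.glue_mem s hs hd hu (fun i => Prod.fst ∘ α i) (fun i => (hα i).1) _
        fun i r hr => congrArg Prod.fst (hβ i r hr),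
      QuasiBorelSpace.glue_mem s hs hd hu (fun i => Prod.snd ∘ α i) (fun i => (hα i).2) _
        fun i r hr => congrArg Prod.snd (hβ i r hr)⟩

instance : QuasiBorelSpace PUnit.{u + 1} where
  rand := Set.univ
  const_mem _ := trivial
  comp_mem _ _ _ _ := trivial
  glue_mem _ _ _ _ _ _ _ _ := trivial

/-- The quasi-Borel structure on a function space: a random function is one whose evaluation
at a reparametrized random argument is random. -/
instance (X Y : QuasiBorel.{u}) : QuasiBorelSpace (Hom X Y) where
  rand := {α | ∀ f : ℝ → ℝ, Measurable f → ∀ β ∈ QuasiBorelSpace.rand (X := X.carrier),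
    (fun r => (α (f r)).toFun (β r)) ∈ QuasiBorelSpace.rand (X := Y.carrier)}
  const_mem h _ _ β hβ := h.map_rand β hβ
  comp_mem _ hα g hg f hf β hβ := hα (g ∘ f) (hg.comp hf) β hβ
  glue_mem s hs hd hu α hα ξ hξ f hf β hβ := by
    -- Gluing happens over the partition pulled back along `f`, which is again Borel because `f` is
    -- measurable.
    refine QuasiBorelSpace.glue_mem (fun i => f ⁻¹' s i) (fun i => hf (hs i))
      (fun i j hij => (hd hij).preimage f) (by rw [← Set.preimage_iUnion, hu, Set.preimage_univ])
      (fun i r => (α i (f r)).toFun (β r)) (fun i => hα i f hf β hβ) _ fun i r hr => ?_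
    rw [hξ i (f r) hr]

/-- The product of quasi-Borel spaces. -/
def prod (X Y : QuasiBorel.{u}) : QuasiBorel.{u} := ⟨X.carrier × Y.carrier⟩

/-- The function space of quasi-Borel spaces. -/
def exp (X Y : QuasiBorel.{u}) : QuasiBorel.{u} := ⟨Hom X Y⟩

theorem isCartesianClosed : IsCartesianClosed QuasiBorel.{u} :=
  IsCartesianClosed.of_universal ⟨PUnit⟩ (fun _ => ⟨fun _ => PUnit.unit, fun _ _ => trivial⟩)
    (fun _ => rfl) prod
    (fun X Y => (⟨Prod.fst, fun _ h => h.1⟩ : Hom (prod X Y) X))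
    (fun X Y => (⟨Prod.snd, fun _ h => h.2⟩ : Hom (prod X Y) Y))
    (fun {W X Y} f g => (⟨fun w => (f.toFun w, g.toFun w), fun α h =>
      ⟨f.map_rand α h, g.map_rand α h⟩⟩ : Hom W (prod X Y)))
    (fun _ _ => rfl) (fun _ _ => rfl)
    (fun h₁ h₂ => Hom.ext <| funext fun w => Prod.ext
      (congrFun (congrArg Hom.toFun h₁) w) (congrFun (congrArg Hom.toFun h₂) w))
    exp
    -- Evaluation needs only the trivial reparametrization; general ones make the function space
    -- closed under precomposition.
    (fun X Y => (⟨fun p => p.2.toFun p.1, fun _ h => h.2 id measurable_id _ h.1⟩ :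
      Hom (prod X (exp X Y)) Y))
    (fun {X Y Z} f => (⟨fun z => ⟨fun x => f.toFun (x, z), fun β hβ =>
        f.map_rand (fun r => (β r, z)) ⟨hβ, QuasiBorelSpace.const_mem z⟩⟩,
      fun α hα g hg β hβ => f.map_rand (fun r => (β r, α (g r)))
        ⟨hβ, QuasiBorelSpace.comp_mem α hα g hg⟩⟩ : Hom Z (exp X Y)))
    (fun _ => rfl)
    (fun h => Hom.ext <| funext fun z => Hom.ext <| funext fun x =>
      congrFun (congrArg Hom.toFun h) (x, z))

end QuasiBorel

/-! ### Diffeological spaces -/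

namespace Diffeo

open Diffeology

instance (X Y : Type u) [DiffeologicalSpace X] [DiffeologicalSpace Y] :
    DiffeologicalSpace (X × Y) where
  plots n := {p | IsPlot (Prod.fst ∘ p) ∧ IsPlot (Prod.snd ∘ p)}
  constant_plots _ := ⟨isPlot_const, isPlot_const⟩
  plot_reparam hp hf := ⟨isPlot_reparam hp.1 hf, isPlot_reparam hp.2 hf⟩
  locality hp :=
    ⟨DiffeologicalSpace.locality fun x => by
        obtain ⟨u, hu, hx, h⟩ := hp x
        exact ⟨u, hu, hx, fun hf hf' => (h hf hf').1⟩,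
      DiffeologicalSpace.locality fun x => by
        obtain ⟨u, hu, hx, h⟩ := hp x
        exact ⟨u, hu, hx, fun hf hf' => (h hf hf').2⟩⟩

instance : DiffeologicalSpace PUnit.{u + 1} where
  plots _ := Set.univ
  constant_plots _ := trivial
  plot_reparam _ _ := trivial
  locality _ := trivial

/-- The functional diffeology: a plot is a family of smooth maps whose evaluation along a
reparametrization and a plot of arguments is a plot. -/
instance (X Y : Diffeo.{u}) : DiffeologicalSpace (Hom X Y) where
  plots n := {p | ∀ (m : ℕ) (f : EuclideanSpace ℝ (Fin m) → EuclideanSpace ℝ (Fin n))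
    (q : EuclideanSpace ℝ (Fin m) → X.carrier), ContDiff ℝ (⊤ : ℕ∞) f → IsPlot q →
      IsPlot fun a => (p (f a)).toFun (q a)}
  constant_plots h m _ q _ hq := h.smooth m q hq
  plot_reparam hp hg m f q hf hq := hp m _ q (hg.comp hf) hq
  locality {n p} hp m f q hf hq := by
    refine DiffeologicalSpace.locality fun a => ?_
    obtain ⟨u, hu, ha, h⟩ := hp (f a)
    -- A parametrization `g` into `f ⁻¹' u` gives `f ∘ g` into `u`, where `p` is locally a plot;
    -- testing `p ∘ f ∘ g` with the identity and `q ∘ g` gives the claim.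
    exact ⟨f ⁻¹' u, hu.preimage hf.continuous, ha, fun {k g} hg hg' =>
      h (f := f ∘ g) hg (hf.comp hg') k id (q ∘ g) contDiff_id (isPlot_reparam hq hg')⟩

/-- The product of diffeological spaces. -/
def prod (X Y : Diffeo.{u}) : Diffeo.{u} := ⟨X.carrier × Y.carrier⟩

/-- The space of smooth maps between diffeological spaces. -/
def exp (X Y : Diffeo.{u}) : Diffeo.{u} := ⟨Hom X Y⟩

theorem isCartesianClosed : IsCartesianClosed Diffeo.{u} :=
  IsCartesianClosed.of_universal ⟨PUnit⟩ (fun _ => ⟨fun _ => PUnit.unit, fun _ _ _ => trivial⟩)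
    (fun _ => rfl) prod
    (fun X Y => (⟨Prod.fst, fun _ _ h => h.1⟩ : Hom (prod X Y) X))
    (fun X Y => (⟨Prod.snd, fun _ _ h => h.2⟩ : Hom (prod X Y) Y))
    (fun {W X Y} f g => (⟨fun w => (f.toFun w, g.toFun w), fun n p h =>
      ⟨f.smooth n p h, g.smooth n p h⟩⟩ : Hom W (prod X Y)))
    (fun _ _ => rfl) (fun _ _ => rfl)
    (fun h₁ h₂ => Hom.ext <| funext fun w => Prod.ext
      (congrFun (congrArg Hom.toFun h₁) w) (congrFun (congrArg Hom.toFun h₂) w))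
    exp
    (fun X Y => (⟨fun p => p.2.toFun p.1, fun n _ h => h.2 n id _ contDiff_id h.1⟩ :
      Hom (prod X (exp X Y)) Y))
    (fun {X Y Z} f => (⟨fun z => ⟨fun x => f.toFun (x, z), fun n q hq =>
        f.smooth n (fun a => (q a, z)) ⟨hq, isPlot_const⟩⟩,
      fun _ p hp m g q hg hq => f.smooth m (fun a => (q a, p (g a)))
        ⟨hq, isPlot_reparam hp hg⟩⟩ : Hom Z (exp X Y)))
    (fun _ => rfl)
    (fun h => Hom.ext <| funext fun z => Hom.ext <| funext fun x =>
      congrFun (congrArg Hom.toFun h) (x, z))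

end Diffeo

/-! ### Weakly Hausdorff spaces -/

section WeaklyHausdorff

variable {X Y : Type u} [TopologicalSpace X] [TopologicalSpace Y]

/-- A continuous map from a compact Hausdorff space to a weakly Hausdorff space is closed. -/
lemma isClosedMap_of_weaklyHausdorff [WeaklyHausdorffSpace Y] {K : Type u} [TopologicalSpace K]
    [CompactSpace K] [T2Space K] {f : K → Y} (hf : Continuous f) : IsClosedMap f := by
  intro s hs
  have : CompactSpace s := isCompact_iff_compactSpace.1 hs.isCompact
  -- A closed subset of `K` is itself a compact Hausdorff test space.
  have h := WeaklyHausdorffSpace.isClosed_range (X := Y) (CompHaus.of s)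
    ⟨f ∘ Subtype.val, hf.comp continuous_subtype_val⟩
  rwa [ContinuousMap.coe_mk, Set.range_comp, Subtype.range_coe] at h

lemma isClosed_singleton_of_weaklyHausdorff [WeaklyHausdorffSpace Y] (y : Y) :
    IsClosed ({y} : Set Y) := by
  have h := WeaklyHausdorffSpace.isClosed_range (X := Y) (CompHaus.of PUnit.{u + 1})
    ⟨fun _ => y, continuous_const⟩
  have e : Set.range (fun _ : PUnit.{u + 1} => y) = {y} := Set.range_const
  exact e ▸ h

/-- Two continuous maps from a compact Hausdorff space to a weakly Hausdorff space agree on a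
closed set. -/
lemma isClosed_eqLocus_of_weaklyHausdorff [WeaklyHausdorffSpace Y] {K : Type u}
    [TopologicalSpace K] [CompactSpace K] [T2Space K] {f g : K → Y} (hf : Continuous f)
    (hg : Continuous g) : IsClosed {k | f k = g k} := by
  -- Combining `f` and `g` gives one closed map from a normal space, so disjoint fibres can be
  -- separated upstairs and the separation pushed down to `Y`.
  let h : K ⊕ K → Y := Sum.elim f g
  have hh : Continuous h := hf.sumElim hg
  have hc : IsClosedMap h := isClosedMap_of_weaklyHausdorff hh
  rw [← isOpen_compl_iff, isOpen_iff_forall_mem_open]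
  intro k hk
  have hd : Disjoint (h ⁻¹' {f k}) (h ⁻¹' {g k}) :=
    Disjoint.preimage h (Set.disjoint_singleton.2 hk)
  obtain ⟨U, V, hU, hV, hfU, hgV, hUV⟩ := normal_separation
    ((isClosed_singleton_of_weaklyHausdorff (f k)).preimage hh)
    ((isClosed_singleton_of_weaklyHausdorff (g k)).preimage hh) hd
  -- Over the open set `(h '' Uᶜ)ᶜ` the whole fibre lies in `U`, and likewise for `V`; a common
  -- value of `f` and `g` at `l` would put `Sum.inl l` in both.
  refine ⟨f ⁻¹' (h '' Uᶜ)ᶜ ∩ g ⁻¹' (h '' Vᶜ)ᶜ, ?_, ?_, ?_, ?_⟩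
  · rintro l ⟨hl₁, hl₂⟩ (hl : f l = g l)
    have h₁ : Sum.inl l ∈ U := by
      by_contra hn
      exact hl₁ ⟨Sum.inl l, hn, rfl⟩
    have h₂ : Sum.inl l ∈ V := by
      by_contra hn
      exact hl₂ ⟨Sum.inl l, hn, hl⟩
    exact Set.disjoint_left.1 hUV h₁ h₂
  · exact ((hc _ hU.isClosed_compl).isOpen_compl.preimage hf).inter
      ((hc _ hV.isClosed_compl).isOpen_compl.preimage hg)
  · rintro ⟨x, hx, hxk⟩
    exact hx (hfU hxk)
  · rintro ⟨x, hx, hxk⟩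
    exact hx (hgV hxk)

/-- A compactly generated space whose points are separated by continuous maps to weakly Hausdorff
spaces is weakly Hausdorff. -/
lemma WeaklyHausdorffSpace.of_separating [CompactlyGeneratedSpace X]
    (h : ∀ x y : X, (∀ (Z : CGWH.{u}) (p : C(X, Z.carrier)), p x = p y) → x = y) :
    WeaklyHausdorffSpace X where
  isClosed_range K f := by
    refine UCompactlyGeneratedSpace.isClosed.{u} fun L g => ?_
    -- The preimage is the projection of the coincidence set along the compact factor `K`. That set
    -- is an intersection of equalizers of maps from the compact Hausdorff space `K × L` to weakly
    -- Hausdorff spaces.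
    have e : g ⁻¹' Set.range f = Prod.snd '' {q : K × L | f q.1 = g q.2} := by
      ext l
      exact ⟨fun ⟨k, hk⟩ => ⟨(k, l), hk, rfl⟩, fun ⟨⟨k, l'⟩, hk, hl⟩ => ⟨k, hl ▸ hk⟩⟩
    have e' : {q : K × L | f q.1 = g q.2} =
        ⋂ (Z : CGWH.{u}) (p : C(X, Z.carrier)), {q : K × L | p (f q.1) = p (g q.2)} := by
      ext q
      simp only [Set.mem_ofPred_eq, Set.mem_iInter]
      exact ⟨fun hq Z p => congrArg p hq, fun hq => h _ _ hq⟩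
    have hcl : IsClosed {q : K × L | f q.1 = g q.2} := by
      rw [e']
      exact isClosed_iInter fun Z => isClosed_iInter fun p =>
        isClosed_eqLocus_of_weaklyHausdorff (by fun_prop) (by fun_prop)
    rw [e]
    exact isClosedMap_snd_of_compactSpace _ hcl

end WeaklyHausdorff

/-! ### Compactly generated weakly Hausdorff spaces -/

namespace CGWH

open Topology

lemma locallyCompactSpace_of_compact_t2 (K : Type u) [TopologicalSpace K] [CompactSpace K]
    [T2Space K] : LocallyCompactSpace K := inferInstance

/-- The family of compact Hausdorff spaces, which generates the compactly generated spaces. -/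
abbrev testSpace (K : CompHaus.{u}) : Type u := K

instance (K : CompHaus.{u}) : LocallyCompactSpace (testSpace K) :=
  locallyCompactSpace_of_compact_t2 K

/-- A product of two test spaces is compact Hausdorff, hence itself a test space. -/
instance (K L : CompHaus.{u}) : IsGeneratedBy testSpace.{u} (testSpace K × testSpace L) :=
  inferInstanceAs (IsGeneratedBy testSpace.{u} (testSpace (CompHaus.of (K × L))))

/-- Bridges compact generation with the theory of spaces generated by a family, which supplies
function spaces and currying. -/
instance isGeneratedBy (X : Type u) [TopologicalSpace X] [CompactlyGeneratedSpace X] :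
    IsGeneratedBy testSpace.{u} X where
  continuous_equiv_symm := continuous_from_uCompactlyGeneratedSpace.{u} _ fun K g => by
    rw [IsGeneratedBy.equiv_symm_comp_continuous_iff (X := testSpace.{u}) (Y := testSpace K)]
    exact g.continuous

instance compactlyGeneratedSpace (X : Type u) [TopologicalSpace X] :
    CompactlyGeneratedSpace (WithGeneratedByTopology testSpace.{u} X) :=
  uCompactlyGeneratedSpace_of_isClosed fun _ hs =>
    (IsGeneratedBy.isClosed_iff testSpace.{u}).2 fun K f => hs K f

/-- A `testSpace`-continuous map out of a compactly generated space is continuous. -/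
lemma continuous_of_continuousGeneratedBy {X Y : Type u} [TopologicalSpace X]
    [CompactlyGeneratedSpace X] [TopologicalSpace Y] {f : X → Y}
    (hf : ContinuousGeneratedBy testSpace.{u} f) :
    Continuous ((WithGeneratedByTopology.equiv (X := testSpace.{u})).symm ∘ f) :=
  (IsGeneratedBy.equiv_symm_comp_continuous_iff testSpace.{u} f).2
    ((IsGeneratedBy.continuous_iff testSpace.{u} f).2 hf)

/-- The underlying space of the product. -/
abbrev Prod (X Y : CGWH.{u}) : Type u :=
  WithGeneratedByTopology testSpace.{u} (X.carrier × Y.carrier)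

/-- The underlying space of the exponential. -/
abbrev Exp (X Y : CGWH.{u}) : Type u :=
  WithGeneratedByTopology testSpace.{u}
    (ContinuousMapGeneratedBy testSpace.{u} X.carrier Y.carrier)

/-- The first projection of the product. -/
def fst (X Y : CGWH.{u}) : C(Prod X Y, X.carrier) :=
  ⟨_, continuous_fst.comp WithGeneratedByTopology.continuous_equiv⟩

/-- The second projection of the product. -/
def snd (X Y : CGWH.{u}) : C(Prod X Y, Y.carrier) :=
  ⟨_, continuous_snd.comp WithGeneratedByTopology.continuous_equiv⟩

/-- The pairing of two continuous maps. -/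
def pair {W : Type u} [TopologicalSpace W] [CompactlyGeneratedSpace W] {X Y : CGWH.{u}}
    (f : C(W, X.carrier)) (g : C(W, Y.carrier)) : C(W, Prod X Y) :=
  ⟨_, continuous_of_continuousGeneratedBy (f.prodMk g).continuous.continuousGeneratedBy⟩

/-- The evaluation of a function at a point, jointly continuous in both. -/
lemma continuous_eval (X Y : CGWH.{u}) {W : Type u} [TopologicalSpace W]
    [CompactlyGeneratedSpace W] (x : C(W, X.carrier)) (c : C(W, Exp X Y)) :
    Continuous fun w => WithGeneratedByTopology.equiv (c w) (x w) := by
  have h := (ContinuousMapGeneratedBy.ev (X := testSpace.{u}) (Y := X.carrier)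
    (Z := Y.carrier)).prop.comp
      (x.continuous.prodMk
        (WithGeneratedByTopology.continuous_equiv.comp c.continuous)).continuousGeneratedBy
  exact (IsGeneratedBy.continuous_iff testSpace.{u} _).2 h

/-- The two projections separate points. -/
instance (X Y : CGWH.{u}) : WeaklyHausdorffSpace (Prod X Y) :=
  .of_separating fun _ _ h => _root_.Prod.ext (h X (fst X Y)) (h Y (snd X Y))

/-- Evaluations at the points of `X` separate functions. -/
instance (X Y : CGWH.{u}) : WeaklyHausdorffSpace (Exp X Y) :=
  .of_separating fun _ _ h => ContinuousMapGeneratedBy.ext <| funext fun x =>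
    h Y ⟨_, continuous_eval X Y (.const _ x) (.id _)⟩

instance : WeaklyHausdorffSpace PUnit.{u + 1} where
  isClosed_range _ _ := isClosed_discrete _

/-- The product of compactly generated weakly Hausdorff spaces. -/
def prod (X Y : CGWH.{u}) : CGWH.{u} := ⟨Prod X Y⟩

/-- The exponential of compactly generated weakly Hausdorff spaces. -/
def exp (X Y : CGWH.{u}) : CGWH.{u} := ⟨Exp X Y⟩

/-- The currying of a continuous map out of a product. -/
def curry {X Y Z : CGWH.{u}} (f : C(Prod X Z, Y.carrier)) : C(Z.carrier, Exp X Y) :=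
  ⟨_, continuous_of_continuousGeneratedBy (ContinuousMapGeneratedBy.curryEquiv
    (X := testSpace.{u}) (Y := X.carrier) (Z := Z.carrier) (T := Y.carrier)
    ⟨f ∘ WithGeneratedByTopology.equiv.symm,
      f.continuous.continuousGeneratedBy.comp
        (WithGeneratedByTopology.equivSymmAsContinuousMapGeneratedBy _ _).prop⟩).prop⟩

theorem isCartesianClosed : IsCartesianClosed CGWH.{u} :=
  IsCartesianClosed.of_universal ⟨PUnit⟩
    (fun X => (.const X.carrier PUnit.unit : C(X.carrier, PUnit)))
    (fun _ => rfl) prod fst snd (fun f g => pair f g) (fun _ _ => rfl) (fun _ _ => rfl)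
    (fun {W X Y} _ _ h₁ h₂ => ContinuousMap.ext fun w => _root_.Prod.ext
      (DFunLike.congr_fun (F := C(W.carrier, X.carrier)) h₁ w)
      (DFunLike.congr_fun (F := C(W.carrier, Y.carrier)) h₂ w))
    exp
    (fun X Y => (⟨_, continuous_eval X Y (fst X (exp X Y)) (snd X (exp X Y))⟩ :
      C(Prod X (exp X Y), Y.carrier)))
    (fun f => curry f) (fun _ => rfl)
    (fun {X Y Z} _ _ h => ContinuousMap.ext fun z => ContinuousMapGeneratedBy.ext <|
      funext fun x => DFunLike.congr_fun (F := C(Prod X Z, Y.carrier)) h (x, z))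

end CGWH

theorem mainTheorem9 :
    (IsCartesianClosed (Type u) ∧ InducesDynamics (Type u)) ∧
    (IsCartesianClosed CGWH.{u} ∧ InducesDynamics CGWH.{u}) ∧
    (IsCartesianClosed QuasiBorel.{u} ∧ InducesDynamics QuasiBorel.{u}) ∧
    (IsCartesianClosed Diffeo.{u} ∧ InducesDynamics Diffeo.{u}) :=
  ⟨⟨isCartesianClosed_type, inducesDynamics _⟩, ⟨CGWH.isCartesianClosed, inducesDynamics _⟩,
    ⟨QuasiBorel.isCartesianClosed, inducesDynamics _⟩,
    ⟨Diffeo.isCartesianClosed, inducesDynamics _⟩⟩
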